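/- All graphs are finite and simple. In the game of lions and contamination on a connected graph $G=(V,E)$ with $m$ lions, the lions are placed on vertices at time $0$, and in each step every lion stays or moves to an adjacent vertex (several lions may share a vertex). Let $L_t$ be the set of vertices occupied at time $t$, and let $\pi_t$ be the set of pairs $(u,v)$ such that some lion is at $u$ at time $t-1$ and at $v$ at time $t$. The contaminated sets are $W_0=V\setminus L_0$ and, for $t\ge 1$, $$W_t=(W_{t-1}\setminus L_t)\cup\{v\in V\setminus L_t : \exists\, w\in W_{t-1},\ \{v,w\}\in E,\ (v,w)\notin\pi_t,\ (w,v)\notin\pi_t\}.$$ The lion number $\mathcal{L}(G)$ is the least $m$ such that $m$ lions can move so that $W_T=\emptyset$ for some $T$. A path decomposition of $G$ is a sequence $B_1,\dots,B_n$ of subsets of $V$ that cover $V$, such that every edge lies in some $B_i$ and $B_i\cap B_j\subseteq B_m$ whenever $i\le m\le j$; its width is $\max_i|B_i|-1$, and the pathwidth $\operatorname{pw}(G)$ is the least width of a path decomposition of $G$. Let $t_1=1$ and $t_{i+1}=4t_i+15$ for $i\ge 1$. Let $T_1$ be the tree consisting of a root and two leaves. For $i\ge1$ let $T_{i+1}$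 be the tree consisting of a new root, two disjoint copies of $T_i$, and two internally disjoint paths, with $t_i+5$ internal vertices each, that join the new root to the roots of the two copies. Let $G_i$ be the graph obtained from $T_i$ by adding one vertex that is adjacent to all vertices of $T_i$. **Theorem.** For every positive integer $k$ there is a finite connected graph $G$ with $\mathcal{L}(G)\le 3$ and $\operatorname{pw}(G)\ge k$. Indeed, for every $i\ge1$ the graph $G_i$ is connected and satisfies $\mathcal{L}(G_i)\le 3$ and $\operatorname{pw}(G_i)\ge\lceil i/2\rceil$, so that $G_{2k}$ is such a graph. -/

import Mathlib

namespace Lions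

/-! ### The lions and contamination game -/

section Game

variable {V : Type*}

/-- A schedule for `m` lions on `G`: `pos t j` is the position of lion `j` at time `t`.
In each step every lion stays or moves to an adjacent vertex; lions may share a vertex. -/
structure Schedule (G : SimpleGraph V) (m : ℕ) where
  pos : ℕ → Fin m → V
  step : ∀ t j, pos (t + 1) j = pos t j ∨ G.Adj (pos t j) (pos (t + 1) j)

namespace Schedule

variable {G : SimpleGraph V} {m : ℕ}

/-- The set `L_t` of vertices occupied by lions at time `t`. -/
def occupied (p : Schedule G m) (t : ℕ) : Set V := Set.range (p.pos t)

/-- The set of moves `(u, v)` made by the lions from time `t` to time `t + 1`. -/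
def moves (p : Schedule G m) (t : ℕ) : Set (V × V) :=
  Set.range fun j => (p.pos t j, p.pos (t + 1) j)

/-- The set `W_t` of contaminated vertices at time `t`. -/
def contaminated (p : Schedule G m) : ℕ → Set V
  | 0 => (p.occupied 0)ᶜ
  | t + 1 =>
      (p.contaminated t \ p.occupied (t + 1)) ∪
        {v | v ∉ p.occupied (t + 1) ∧
          ∃ w ∈ p.contaminated t, G.Adj v w ∧ (v, w) ∉ p.moves t ∧ (w, v) ∉ p.moves t}

/-- The schedule clears the graph: at some time no vertex is contaminated. -/
def Clears (p : Schedule G m) : Prop := ∃ T, p.contaminated T = ∅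

end Schedule

/-- `G` can be cleared with `m` lions. -/
def Clearable (G : SimpleGraph V) (m : ℕ) : Prop := ∃ p : Schedule G m, p.Clears

/-- The lion number: the least number of lions that can clear `G`. -/
noncomputable def lionNumber (G : SimpleGraph V) : ℕ := sInf {m | Clearable G m}

/-- On a finite graph some number of lions suffices, so the minimum is over a nonempty set. -/
theorem clearable_lionNumber [Finite V] (G : SimpleGraph V) : Clearable G (lionNumber G) := by
  have h : {m | Clearable G m}.Nonempty := by
    obtain ⟨n, ⟨e⟩⟩ := Finite.exists_equiv_fin V
    refine ⟨n, ⟨fun _ => e.symm, fun _ _ => Or.inl rfl⟩, 0, ?_⟩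
    simp [Schedule.contaminated, Schedule.occupied]
  exact Nat.sInf_mem h

end Game

/-! ### Pathwidth -/

section Pathwidth

variable {V : Type*}

/-- A path decomposition of `G`, with bags indexed by `0, …, n - 1`. -/
structure PathDecomposition (G : SimpleGraph V) where
  n : ℕ
  bag : Fin n → Finset V
  cover : ∀ v, ∃ i, v ∈ bag i
  interval : ∀ i j m : Fin n, i ≤ m → m ≤ j → ∀ v, v ∈ bag i → v ∈ bag j → v ∈ bag m
  edge : ∀ v w, G.Adj v w → ∃ i, v ∈ bag i ∧ w ∈ bag i

/-- The width: the largest size of a bag, minus one. (For a graph with at least one vertex the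
largest bag is nonempty, so the subtraction is not truncated.) -/
def PathDecomposition.width {G : SimpleGraph V} (D : PathDecomposition G) : ℕ :=
  (Finset.univ.sup fun i => (D.bag i).card) - 1

/-- The pathwidth: the least width of a path decomposition. -/
noncomputable def pathwidth (G : SimpleGraph V) : ℕ :=
  sInf (Set.range fun D : PathDecomposition G => D.width)

/-- On a finite graph a path decomposition exists, so the minimum is over a nonempty set. -/
theorem exists_width_eq_pathwidth [Finite V] (G : SimpleGraph V) :
    ∃ D : PathDecomposition G, D.width = pathwidth G := by
  have h : (Set.range fun D : PathDecomposition G => D.width).Nonempty := by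
    have := Fintype.ofFinite V
    exact ⟨_, ⟨1, fun _ => Finset.univ, fun _ => ⟨0, Finset.mem_univ _⟩,
      fun _ _ _ _ _ v _ _ => Finset.mem_univ v,
      fun v w _ => ⟨0, Finset.mem_univ v, Finset.mem_univ w⟩⟩, rfl⟩
  exact Nat.sInf_mem h

end Pathwidth

/-! ### The trees `T_i` and the graphs `G_i` -/

section Construction

variable {V : Type*}

/-- The vertices of the graph made of two copies of a graph on `V`, two paths with `n` internal
vertices each, and a new root: `none` is the new root, `some (b, Sum.inl v)` is the vertex `v` of
copy `b`, and `some (b, Sum.inr j)` is the `j`-th internal vertex of path `b`. -/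
abbrev JoinVertex (V : Type*) (n : ℕ) : Type _ := Option (Bool × (V ⊕ Fin n))

/-- The vertices, numbered `0, …, n + 1`, of the path from the root `r` of copy `b` to the new
root, which has the internal vertices `1, …, n`. -/
def joinPath (n : ℕ) (r : V) (b : Bool) : ℕ → JoinVertex V n
  | 0 => some (b, Sum.inl r)
  | j + 1 => if h : j < n then some (b, Sum.inr ⟨j, h⟩) else none

/-- The edges of the two copies and of the two paths. -/
def JoinRel (n : ℕ) (T : SimpleGraph V) (r : V) (p q : JoinVertex V n) : Prop :=
  (∃ b x y, T.Adj x y ∧ p = some (b, Sum.inl x) ∧ q = some (b, Sum.inl y)) ∨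
    ∃ b j, j ≤ n ∧ p = joinPath n r b j ∧ q = joinPath n r b (j + 1)

/-- A new root joined to the roots `r` of two disjoint copies of `T` by two paths with `n`
internal vertices each. -/
def joinCopies (n : ℕ) (T : SimpleGraph V) (r : V) : SimpleGraph (JoinVertex V n) :=
  SimpleGraph.fromRel (JoinRel n T r)

/-- `G` with an additional vertex `none` that is adjacent to all vertices of `G`. -/
def addUniversal (G : SimpleGraph V) : SimpleGraph (Option V) where
  Adj
    | none, none => False
    | none, some _ => True
    | some _, none => True
    | some v, some w => G.Adj v w
  symm := ⟨by
    rintro (_ | v) (_ | w) h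
    · exact h
    · trivial
    · trivial
    · exact G.adj_symm h⟩
  loopless := ⟨by
    rintro (_ | v) h
    · exact h
    · exact G.loopless.irrefl v h⟩

/-- `clearTime i` is `t_i`: `t_1 = 1` and `t_{i+1} = 4 t_i + 15`. The value at `0` is not used. -/
def clearTime : ℕ → ℕ
  | 0 => 0
  | 1 => 1
  | i + 2 => 4 * clearTime (i + 1) + 15

/-- The number of internal vertices of the two paths in `T_{i+1}`: it is `t_i + 5` for `1 ≤ i`.
The value `0` at `0` makes `T_1`, built from two copies of a one-vertex graph `T_0`, a root with
two leaves. -/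
def gap : ℕ → ℕ
  | 0 => 0
  | i + 1 => clearTime (i + 1) + 5

/-- The vertices of `T_i`. -/
def TreeVertex : ℕ → Type
  | 0 => Unit
  | i + 1 => JoinVertex (TreeVertex i) (gap i)

/-- The root of `T_i`. -/
def treeRoot : (i : ℕ) → TreeVertex i
  | 0 => ()
  | _ + 1 => none

/-- The tree `T_i`. -/
def tree : (i : ℕ) → SimpleGraph (TreeVertex i)
  | 0 => ⊥
  | i + 1 => joinCopies (gap i) (tree i) (treeRoot i)

/-- The graph `G_i`: the tree `T_i` with a universal vertex added. -/
def lionGraph (i : ℕ) : SimpleGraph (Option (TreeVertex i)) := addUniversal (tree i)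

instance instFiniteTreeVertex : (i : ℕ) → Finite (TreeVertex i)
  | 0 => inferInstanceAs (Finite Unit)
  | i + 1 =>
    have := instFiniteTreeVertex i
    inferInstanceAs (Finite (JoinVertex (TreeVertex i) (gap i)))

end Construction

end Lions

/-! Upper bound. A lion that stays on the universal vertex keeps it clean, so contamination spreads
only along tree edges, while the two other lions can jump anywhere in two steps. By induction these
two, starting at the root of `T_i`, clear it in at most `t_i` steps and the root is never
contaminated. For the recursion (`PairRun.joinCopies`) they walk down both paths, which confines
contamination to the two copies, gather at the root of one copy and clear it. Meanwhile
contamination creeps up the other path, one edge per step; the path is long enough for the lions to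
jump ahead of it, drive it back and clear the second copy. The strategy for a copy can be reused
because its root stays clean, so nothing leaks out of it (`PairRun.transfer`).

Lower bound. `T_{i+2}` contains four disjoint copies of `T_i`, and deleting any one of them leaves a
connected graph. By induction each copy has a bag rich in its own vertices. Among three such bags
one lies between the other two; the connected remainder has vertices in bags on both sides, so it
must meet the middle bag and adds a vertex to it. Thus two levels of the tree gain one vertex
(`PathDecomposition.exists_bag_card`). -/

namespace Lions

/-! ### Two free lions and a guarded universal vertex -/

section Clearing

variable {V X : Type*}

/-- One step of two lions on `T`, each of which may also step to (position `none`) or from a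
vertex adjacent to all of `T`, when a further lion never leaves that vertex. The sets `W` and `W'`
are upper bounds for the contaminated sets before and after the step. -/
def PairStep (T : SimpleGraph V) (p p' : Bool → Option V) (W W' : Set V) : Prop :=
  (∀ l, p' l = p l ∨ (addUniversal T).Adj (p l) (p' l)) ∧
    ∀ v, (∀ l, p' l ≠ some v) →
      (v ∈ W ∨ ∃ w ∈ W, T.Adj v w ∧ ∀ l, ¬ (p l = some v ∧ p' l = some w)) → v ∈ W'

/-- A sequence of `n` steps of two lions during which the vertex `r` is never contaminated. -/
inductive PairRun (T : SimpleGraph V) (r : V) :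
    ℕ → (Bool → Option V) → Set V → (Bool → Option V) → Set V → Prop
  | refl {p W} (h : r ∉ W) : PairRun T r 0 p W p W
  | tail {n p W p' W' p'' W''} (h : PairRun T r n p W p' W') (hs : PairStep T p' p'' W' W'')
      (hr : r ∉ W'') : PairRun T r (n + 1) p W p'' W''

theorem PairRun.trans {T : SimpleGraph V} {r : V} {m n : ℕ} {p p' p'' : Bool → Option V}
    {W W' W'' : Set V} (h : PairRun T r m p W p' W') (h' : PairRun T r n p' W' p'' W'') :
    PairRun T r (m + n) p W p'' W'' := by
  induction h' with
  | refl _ => exact h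
  | tail _ hs hr ih => exact (ih h).tail hs hr

theorem PairRun.of_seq {T : SimpleGraph V} {r : V} (P : ℕ → Bool → Option V) (S : ℕ → Set V)
    (n : ℕ) (hs : ∀ k < n, PairStep T (P k) (P (k + 1)) (S k) (S (k + 1)))
    (hr : ∀ k ≤ n, r ∉ S k) : PairRun T r n (P 0) (S 0) (P n) (S n) := by
  induction n with
  | zero => exact .refl (hr 0 le_rfl)
  | succ n ih =>
    exact (ih (fun k hk => hs k (by omega)) (fun k hk => hr k (by omega))).tail
      (hs n (by omega)) (hr _ le_rfl)

theorem PairRun.exists_seq {T : SimpleGraph V} {r : V} {n : ℕ} {p p' : Bool → Option V}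
    {W W' : Set V} (h : PairRun T r n p W p' W') :
    ∃ (P : ℕ → Bool → Option V) (S : ℕ → Set V), P 0 = p ∧ S 0 = W ∧ P n = p' ∧ S n = W' ∧
      ∀ k < n, PairStep T (P k) (P (k + 1)) (S k) (S (k + 1)) := by
  induction h with
  | @refl p W _ => exact ⟨fun _ => p, fun _ => W, rfl, rfl, rfl, rfl, by simp⟩
  | @tail n p W p' W' p'' W'' _ hs _ ih =>
    obtain ⟨P, S, h0, h0', hn, hn', h⟩ := ih
    refine ⟨fun k => if k ≤ n then P k else p'', fun k => if k ≤ n then S k else W'',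
      by simpa using h0, by simpa using h0', by simp, by simp, fun k hk => ?_⟩
    rcases Nat.lt_succ_iff_lt_or_eq.1 hk with hk | rfl
    · simpa [hk.le, Nat.succ_le_iff.2 hk] using h k hk
    · simpa [hn, hn'] using hs

/-- A run on `T` that keeps `r` clean is a run on every graph in which `T` is attached to the
rest through `r` only, with a contaminated set `U k` outside that grows freely. -/
theorem PairRun.transfer {T : SimpleGraph V} {r : V} {H : SimpleGraph X} {ρ : X} {f : V → X}
    (hom : ∀ x y, T.Adj x y → H.Adj (f x) (f y))
    (hattach : ∀ x v, x ≠ r → H.Adj v (f x) → ∃ y, v = f y ∧ T.Adj y x)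
    (hρ : ∀ x, f x ≠ ρ) {n : ℕ} {p p' : Bool → Option V} {W W' : Set V}
    (h : PairRun T r n p W p' W') (U : ℕ → Set X) (hUρ : ∀ k ≤ n, ρ ∉ U k)
    (hU : ∀ k < n, U k ⊆ U (k + 1)) (hU' : ∀ k < n, ∀ v, ∀ w ∈ U k, H.Adj v w → v ∈ U (k + 1)) :
    PairRun H ρ n (fun l => (p l).map f) (f '' W ∪ U 0) (fun l => (p' l).map f)
      (f '' W' ∪ U n) := by
  have hclean : ∀ k ≤ n, ∀ S : Set V, ρ ∉ f '' S ∪ U k := by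
    rintro k hk S (⟨x, -, hx⟩ | hx)
    · exact hρ x hx
    · exact hUρ k hk hx
  induction h with
  | refl _ => exact .refl (hclean 0 le_rfl _)
  | @tail n p W p' W' p'' W'' h hs hr ih =>
    have hW' : r ∉ W' := by cases h <;> assumption
    refine (ih (fun k hk => hUρ k (by omega)) (fun k hk => hU k (by omega))
      (fun k hk => hU' k (by omega)) (fun k hk => hclean k (by omega))).tail ⟨fun l => ?_, ?_⟩
      (hclean _ le_rfl _)
    · rcases hs.1 l with h | h
      · exact .inl (congrArg (Option.map f) h)
      · right
        dsimp only
        cases h1 : p' l <;> cases h2 : p'' l <;> rw [h1, h2] at h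
        · exact h
        · trivial
        · trivial
        · exact hom _ _ h
    · rintro v hv ((⟨x, hx, rfl⟩ | hvU) | ⟨w, ⟨x, hx, rfl⟩ | hwU, hadj, hmv⟩)
      · exact .inl ⟨x, hs.2 x (fun l hl => hv l (by simp [hl])) (.inl hx), rfl⟩
      · exact .inr (hU n (by omega) hvU)
      -- Contamination cannot leave `T` here: `x` is contaminated and `r` is clean, so `x ≠ r`.
      · obtain ⟨y, rfl, hyx⟩ := hattach x v (fun h => hW' (h ▸ hx)) hadj
        refine .inl ⟨y, hs.2 y (fun l hl => hv l (by simp [hl]))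
          (.inr ⟨x, hx, hyx, fun l hl => hmv l ?_⟩), rfl⟩
        simp [hl.1, hl.2]
      · exact .inr (hU' n (by omega) v w hwU hadj)

/-- If two lions that start on `r` clear `T` with the help of a vertex adjacent to all vertices
and guarded by a third lion, then three lions clear `T` with that vertex added. -/
theorem PairRun.clearable {T : SimpleGraph V} {r : V} {n : ℕ} {p' : Bool → Option V}
    (h : PairRun T r n (fun _ => some r) {r}ᶜ p' ∅) : Clearable (addUniversal T) 3 := by
  obtain ⟨P, S, h0, h0', -, hn', hs⟩ := h.exists_seq
  let q : Schedule (addUniversal T) 3 :=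
    { pos := fun t => ![none, P (min t n) false, P (min t n) true]
      step := fun t j => by
        have key : ∀ l, P (min (t + 1) n) l = P (min t n) l ∨
            (addUniversal T).Adj (P (min t n) l) (P (min (t + 1) n) l) := fun l => by
          rcases lt_or_ge t n with ht | ht
          · rw [min_eq_left ht.le, min_eq_left (Nat.succ_le_iff.2 ht)]
            exact (hs t ht).1 l
          · rw [min_eq_right ht, min_eq_right (by omega)]
            exact .inl rfl
        fin_cases j
        · exact .inl rfl
        · exact key false
        · exact key true }
  have hnone : ∀ t, none ∈ q.occupied t := fun t => ⟨0, rfl⟩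
  have hocc : ∀ t l, P (min t n) l ∈ q.occupied t := by
    rintro t (_ | _)
    exacts [⟨1, rfl⟩, ⟨2, rfl⟩]
  have hmov : ∀ t l, (P (min t n) l, P (min (t + 1) n) l) ∈ q.moves t := by
    rintro t (_ | _)
    exacts [⟨1, rfl⟩, ⟨2, rfl⟩]
  have hnotmem : ∀ t, none ∉ q.contaminated t := by
    rintro (_ | t) h
    · exact h (hnone 0)
    · rcases h with h | h
      · exact h.2 (hnone _)
      · exact h.1 (hnone _)
  have main : ∀ t ≤ n, ∀ v, some v ∈ q.contaminated t → v ∈ S t := by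
    intro t
    induction t with
    | zero =>
      intro _ v hv
      rw [h0']
      rintro rfl
      exact hv (by simpa [h0] using hocc 0 true)
    | succ t ih =>
      intro ht v hv
      have e := min_eq_left ht
      have e' : min t n = t := min_eq_left (by omega)
      have hfree : some v ∉ q.occupied (t + 1) := by
        rcases hv with hv | hv
        exacts [hv.2, hv.1]
      refine (hs t ht).2 v (fun l hl => hfree ?_) ?_
      · have := hocc (t + 1) l
        rwa [e, hl] at this
      -- Only moves from `v` to `w` need recording: a lion crossing from `w` to `v` ends on `v`,
      -- which is then occupied.
      · rcases hv with hv | ⟨-, w, hw, hadj, hm, -⟩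
        · exact .inl (ih (by omega) v hv.1)
        · rcases w with _ | w
          · exact absurd hw (hnotmem t)
          · refine .inr ⟨w, ih (by omega) w hw, hadj, fun l hl => hm ?_⟩
            have := hmov t l
            rwa [e, e', hl.1, hl.2] at this
  refine ⟨q, n, Set.eq_empty_of_forall_notMem ?_⟩
  rintro (_ | v) hv
  · exact hnotmem n hv
  · simpa [hn'] using main n le_rfl v hv

/-! ### Depth and adjacency in the joined graph -/

/-- The number of a vertex on its path; it is `0` on the two copies. -/
def joinDepth (n : ℕ) : JoinVertex V n → ℕ
  | none => n + 1
  | some (_, Sum.inl _) => 0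
  | some (_, Sum.inr j) => j + 1

variable {n : ℕ} {T : SimpleGraph V} {r : V}

theorem joinDepth_joinPath (b : Bool) {j : ℕ} (hj : j ≤ n + 1) :
    joinDepth n (joinPath n r b j) = j := by
  rcases j with _ | j
  · rfl
  · by_cases h : j < n
    · simp [joinPath, h, joinDepth]
    · simp only [joinPath, h, dite_false, joinDepth]; omega

theorem joinPath_last (b : Bool) : joinPath n r b (n + 1) = none := by simp [joinPath]

theorem exists_joinPath_eq_some (b : Bool) {j : ℕ} (hj : j ≤ n) :
    ∃ x, joinPath n r b j = some (b, x) := by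
  rcases j with _ | j
  · exact ⟨_, rfl⟩
  · exact ⟨.inr ⟨j, hj⟩, by simp [joinPath, Nat.lt_of_succ_le hj]⟩

theorem eq_joinPath {b : Bool} {x : V ⊕ Fin n} (h : joinDepth n (some (b, x)) ≠ 0) :
    some (b, x) = joinPath n r b (joinDepth n (some (b, x))) := by
  rcases x with x | j
  · exact absurd rfl h
  · simp [joinDepth, joinPath]

theorem joinCopies_adj_inl {b : Bool} {x y : V} (h : T.Adj x y) :
    (joinCopies n T r).Adj (some (b, .inl x)) (some (b, .inl y)) :=
  (SimpleGraph.fromRel_adj _ _ _).2 ⟨by simpa using h.ne, .inl (.inl ⟨b, x, y, h, rfl, rfl⟩)⟩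

theorem joinCopies_adj_joinPath (b : Bool) {j : ℕ} (hj : j ≤ n) :
    (joinCopies n T r).Adj (joinPath n r b (j + 1)) (joinPath n r b j) := by
  refine (SimpleGraph.fromRel_adj _ _ _).2 ⟨fun h => ?_, .inr (.inr ⟨b, j, hj, rfl, rfl⟩)⟩
  have := congrArg (joinDepth n) h
  rw [joinDepth_joinPath b (by omega), joinDepth_joinPath b (by omega)] at this
  omega

theorem joinCopies_adj_cases {v w : JoinVertex V n} (h : (joinCopies n T r).Adj v w) :
    (∃ b x y, T.Adj x y ∧ v = some (b, .inl x) ∧ w = some (b, .inl y)) ∨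
      ∃ b j, j ≤ n ∧ (v = joinPath n r b j ∧ w = joinPath n r b (j + 1) ∨
        v = joinPath n r b (j + 1) ∧ w = joinPath n r b j) := by
  rcases ((SimpleGraph.fromRel_adj _ _ _).1 h).2 with
    (⟨b, x, y, hxy, rfl, rfl⟩ | ⟨b, j, hj, rfl, rfl⟩) |
    (⟨b, x, y, hxy, rfl, rfl⟩ | ⟨b, j, hj, rfl, rfl⟩)
  · exact .inl ⟨b, x, y, hxy, rfl, rfl⟩
  · exact .inr ⟨b, j, hj, .inl ⟨rfl, rfl⟩⟩
  · exact .inl ⟨b, y, x, hxy.symm, rfl, rfl⟩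
  · exact .inr ⟨b, j, hj, .inr ⟨rfl, rfl⟩⟩

theorem joinCopies_attach {b : Bool} {x : V} {v : JoinVertex V n} (hx : x ≠ r)
    (h : (joinCopies n T r).Adj v (some (b, .inl x))) :
    ∃ y, v = some (b, .inl y) ∧ T.Adj y x := by
  rcases joinCopies_adj_cases h with ⟨b', y, z, hyz, rfl, hw⟩ | ⟨b', j, hj, ⟨-, hw⟩ | ⟨-, hw⟩⟩
  · simp only [Option.some.injEq, Prod.mk.injEq, Sum.inl.injEq] at hw
    obtain ⟨rfl, rfl⟩ := hw
    exact ⟨y, rfl, hyz⟩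
  · have := congrArg (joinDepth n) hw
    rw [joinDepth_joinPath b' (by omega)] at this
    simp [joinDepth] at this
  · have := congrArg (joinDepth n) hw
    rw [joinDepth_joinPath b' (by omega)] at this
    obtain rfl : j = 0 := by simpa [joinDepth] using this.symm
    simp [joinPath] at hw
    exact absurd hw.2 hx

/-- A contaminated vertex of branch `b` at depth at most `d ≤ n` spreads within the branch to
depth at most `d + 1`, and to that depth through one edge of the path only. -/
theorem joinCopies_adj_depth {b : Bool} {x : V ⊕ Fin n} {v : JoinVertex V n}
    (h : (joinCopies n T r).Adj v (some (b, x))) :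
    (joinDepth n v ≤ joinDepth n (some (b, x)) ∧ ∃ y, v = some (b, y)) ∨
      (joinDepth n (some (b, x)) ≤ n ∧ v = joinPath n r b (joinDepth n (some (b, x)) + 1) ∧
        some (b, x) = joinPath n r b (joinDepth n (some (b, x)))) := by
  rcases joinCopies_adj_cases h with ⟨b', y, z, hyz, rfl, hw⟩ | ⟨b', j, hj, ⟨hv, hw⟩ | ⟨hv, hw⟩⟩
  · simp only [Option.some.injEq, Prod.mk.injEq] at hw
    obtain ⟨rfl, rfl⟩ := hw
    exact .inl ⟨by simp [joinDepth], _, rfl⟩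
  · left
    have hjn : j < n := by
      rcases hj.lt_or_eq with h | rfl
      · exact h
      · simp [joinPath_last] at hw
    obtain ⟨y, hy⟩ := exists_joinPath_eq_some (r := r) b' (Nat.succ_le_of_lt hjn)
    obtain ⟨z, hz⟩ := exists_joinPath_eq_some (r := r) b' hj
    obtain rfl : b = b' := by
      have := hw.trans hy
      simp only [Option.some.injEq, Prod.mk.injEq] at this
      exact this.1
    refine ⟨?_, z, hv.trans hz⟩
    rw [hv, hw, joinDepth_joinPath b (by omega), joinDepth_joinPath b (by omega)]
    omega
  · right
    obtain ⟨y, hy⟩ := exists_joinPath_eq_some (r := r) b' hj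
    obtain rfl : b = b' := by
      have := hw.trans hy
      simp only [Option.some.injEq, Prod.mk.injEq] at this
      exact this.1
    have hd : joinDepth n (some (b, x)) = j := by rw [hw, joinDepth_joinPath b (by omega)]
    rw [hd]
    exact ⟨hj, hv, hw⟩

/-! ### Sweeping down paths -/

/-- The part of the branches `c l` that is at depth at most `d` and not on a lion, when the
lions stand at depth `d` of the branches `c l`. -/
def walkSet (n : ℕ) (r : V) (c : Bool → Bool) (d : ℕ) : Set (JoinVertex V n) :=
  {v | (∃ l x, v = some (c l, x)) ∧ joinDepth n v ≤ d ∧ ∀ l, v ≠ joinPath n r (c l) d}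

/-- At positive depth a branch has only one vertex of each depth, so the lions occupy all of level
`d`. At depth `0` this fails, since the whole copy lies there. -/
theorem joinDepth_lt_of_mem_walkSet {c : Bool → Bool} {d : ℕ} (hd : 0 < d) {v : JoinVertex V n}
    (hv : v ∈ walkSet n r c d) : joinDepth n v < d := by
  obtain ⟨⟨l, x, rfl⟩, h, h'⟩ := hv
  refine h.lt_of_ne fun e => h' l ?_
  rw [← e]
  exact eq_joinPath (by omega)

/-- Lions that walk down paths clear them. -/
theorem pairStep_walkSet (c : Bool → Bool) {d : ℕ} (hd : d ≤ n) :
    PairStep (joinCopies n T r) (fun l => some (joinPath n r (c l) (d + 1)))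
      (fun l => some (joinPath n r (c l) d)) (walkSet n r c (d + 1)) (walkSet n r c d) := by
  refine ⟨fun l => .inr (joinCopies_adj_joinPath (c l) hd), fun v hfree hv => ?_⟩
  replace hfree : ∀ l, v ≠ joinPath n r (c l) d := fun l h => hfree l (by rw [h])
  rcases hv with hv | ⟨w, hw, hadj, hm⟩
  · exact ⟨hv.1, Nat.lt_succ_iff.1 (joinDepth_lt_of_mem_walkSet (by omega) hv), hfree⟩
  · have hwd := joinDepth_lt_of_mem_walkSet (by omega) hw
    obtain ⟨⟨l, x, rfl⟩, -, -⟩ := hw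
    rcases joinCopies_adj_depth hadj with ⟨h, y, rfl⟩ | ⟨hn, hv, hw⟩
    · exact ⟨⟨l, y, rfl⟩, by omega, hfree⟩
    · generalize joinDepth n (some (c l, x)) = e at *
      -- In the equality case contamination would have to use the very edge that lion `l` crosses in
      -- this step.
      rcases (Nat.lt_succ_iff.1 hwd).lt_or_eq with hlt | rfl
      · obtain ⟨y, hy⟩ := exists_joinPath_eq_some (n := n) (r := r) (c l) (j := e + 1) (by omega)
        refine ⟨⟨l, y, hv.trans hy⟩, ?_, hfree⟩
        rw [hv, joinDepth_joinPath _ (by omega)]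
        omega
      · exact absurd ⟨congrArg some hv.symm, congrArg some hw.symm⟩ (hm l)

theorem pairRun_walkSet (c : Bool → Bool) {d : ℕ} (hd : d ≤ n + 1) :
    PairRun (joinCopies n T r) none d (fun l => some (joinPath n r (c l) d)) (walkSet n r c d)
      (fun l => some (joinPath n r (c l) 0)) (walkSet n r c 0) := by
  have := PairRun.of_seq (T := joinCopies n T r) (r := none)
    (fun k l => some (joinPath n r (c l) (d - k))) (fun k => walkSet n r c (d - k)) d
    (fun k hk => ?_) (fun k _ h => ?_)
  · simpa using this
  · obtain ⟨e, rfl⟩ : ∃ e, d = k + 1 + e := ⟨d - (k + 1), by omega⟩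
    have := pairStep_walkSet (T := T) (r := r) c (n := n) (d := e) (by omega)
    rwa [show k + 1 + e - k = e + 1 by omega, show k + 1 + e - (k + 1) = e by omega]
  · obtain ⟨⟨l, x, hx⟩, -⟩ := h
    exact absurd hx (by simp)

/-- Two lions that start on the new root and walk down the two paths clear everything except the
two copies. -/
theorem pairRun_walkDown : PairRun (joinCopies n T r) none (n + 1) (fun _ => some none) {none}ᶜ
    (fun l => some (some (l, .inl r))) (walkSet n r id 0) := by
  have h := pairRun_walkSet (n := n) (T := T) (r := r) id le_rfl
  have e : walkSet n r id (n + 1) = {none}ᶜ := by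
    ext v
    simp only [walkSet, Set.mem_ofPred_eq, joinPath_last, Set.mem_compl_iff, Set.mem_singleton_iff]
    refine ⟨fun h => h.2.2 true, fun h => ?_⟩
    rcases v with _ | ⟨b, x⟩
    · exact absurd rfl h
    · refine ⟨⟨b, x, rfl⟩, ?_, fun _ => h⟩
      rcases x with x | j
      · simp [joinDepth]
      · have := j.2
        simp only [joinDepth]; omega
  simp only [e, joinPath_last] at h
  exact h

/-! ### The recursive clearing strategy -/

/-- The part of branch `true` at depth at most `d`. -/
def branchSet (V : Type*) (n d : ℕ) : Set (JoinVertex V n) :=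
  {v | (∃ x, v = some (true, x)) ∧ joinDepth n v ≤ d}

theorem none_notMem_branchSet (d : ℕ) : none ∉ branchSet V n d := by
  rintro ⟨⟨x, hx⟩, -⟩
  exact absurd hx (by simp)

theorem branchSet_mono {d e : ℕ} (h : d ≤ e) : branchSet V n d ⊆ branchSet V n e :=
  fun _ hv => ⟨hv.1, hv.2.trans h⟩

theorem mem_branchSet_of_adj {d : ℕ} (hd : d < n) {v w : JoinVertex V n}
    (hw : w ∈ branchSet V n d) (h : (joinCopies n T r).Adj v w) : v ∈ branchSet V n (d + 1) := by
  obtain ⟨⟨x, rfl⟩, hx⟩ := hw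
  rcases joinCopies_adj_depth h with ⟨h, y, rfl⟩ | ⟨hn, hv, -⟩
  · exact ⟨⟨y, rfl⟩, by omega⟩
  · generalize joinDepth n (some (true, x)) = e at *
    obtain ⟨y, hy⟩ := exists_joinPath_eq_some (n := n) (r := r) true (j := e + 1) (by omega)
    refine ⟨⟨y, hv.trans hy⟩, ?_⟩
    rw [hv, joinDepth_joinPath _ (by omega)]
    omega

/-- Unhindered contamination rises by at most one level per step, so this bound holds wherever the
lions go. -/
theorem pairStep_branchSet {d : ℕ} (hd : d < n) {p p' : Bool → Option (JoinVertex V n)}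
    (hp : ∀ l, p' l = p l ∨ (addUniversal (joinCopies n T r)).Adj (p l) (p' l)) :
    PairStep (joinCopies n T r) p p' (branchSet V n d) (branchSet V n (d + 1)) := by
  refine ⟨hp, ?_⟩
  rintro v - (hv | ⟨w, hw, hadj, -⟩)
  · exact branchSet_mono (by omega) hv
  · exact mem_branchSet_of_adj hd hw hadj

/-- A run on a copy that leaves the contamination of branch `true` to itself. -/
theorem PairRun.copy (b : Bool) {s : ℕ} {p p' : Bool → Option V} {W W' : Set V}
    (h : PairRun T r s p W p' W') (U : ℕ → Set (JoinVertex V n)) (hUρ : ∀ k ≤ s, none ∉ U k)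
    (hU : ∀ k < s, U k ⊆ U (k + 1))
    (hU' : ∀ k < s, ∀ v, ∀ w ∈ U k, (joinCopies n T r).Adj v w → v ∈ U (k + 1)) :
    PairRun (joinCopies n T r) none s (fun l => (p l).map fun x => some (b, .inl x))
      ((fun x => some (b, .inl x)) '' W ∪ U 0) (fun l => (p' l).map fun x => some (b, .inl x))
      ((fun x => some (b, .inl x)) '' W' ∪ U s) :=
  h.transfer (fun _ _ h => joinCopies_adj_inl h)
    (fun _ _ hx h => joinCopies_attach hx h) (by simp) U hUρ hU hU'

/-- Once the paths are clean, a lion passes from copy `true` to copy `false`. -/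
theorem pairRun_gather (hn : 0 < n) : PairRun (joinCopies n T r) none 2
    (fun l => some (some (l, .inl r))) (walkSet n r id 0) (fun _ => some (some (false, .inl r)))
    ((fun x => some (false, .inl x)) '' {r}ᶜ ∪ branchSet V n 1) := by
  -- The state while one lion is on the universal vertex: the root of copy `true` may be
  -- contaminated again, but the paths are still clean.
  let M : Set (JoinVertex V n) := {v | ∃ b x, v = some (b, .inl x) ∧ v ≠ some (false, .inl r)}
  have hwalk : ∀ v ∈ walkSet n r id 0, ∃ b x, x ≠ r ∧ v = some (b, .inl x) := by
    rintro v ⟨⟨b, x | j, rfl⟩, h, h'⟩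
    · refine ⟨b, x, fun e => h' b (by rw [e]; rfl), rfl⟩
    · simp [joinDepth] at h
  refine ((PairRun.refl ?_).tail (p'' := fun l => bif l then none else some (some (false, .inl r)))
    (W'' := M) ⟨?_, ?_⟩ ?_).tail ⟨?_, ?_⟩ ?_
  · rintro ⟨⟨l, x, hx⟩, -⟩
    exact absurd hx (by simp)
  · rintro (_ | _)
    · exact .inl rfl
    · exact .inr trivial
  · intro v hfree hv
    have hne : v ≠ some (false, .inl r) := fun h => hfree false (by rw [h]; rfl)
    rcases hv with hv | ⟨w, hw, hadj, -⟩
    · obtain ⟨b, x, -, rfl⟩ := hwalk v hv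
      exact ⟨b, x, rfl, hne⟩
    · obtain ⟨b, x, hx, rfl⟩ := hwalk w hw
      obtain ⟨y, rfl, -⟩ := joinCopies_attach hx hadj
      exact ⟨b, y, rfl, hne⟩
  · rintro ⟨b, x, h, -⟩
    exact absurd h (by simp)
  · rintro (_ | _)
    · exact .inl rfl
    · exact .inr trivial
  · intro v hfree hv
    have hne : v ≠ some (false, .inl r) := fun h => hfree false (by rw [h])
    have hfalse : ∀ y, v = some (false, .inl y) →
        v ∈ (fun x => (some (false, .inl x) : JoinVertex V n)) '' {r}ᶜ :=
      fun y hy => ⟨y, fun h => hne (by rw [hy, h]), hy.symm⟩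
    rcases hv with ⟨b, x, rfl, -⟩ | ⟨w, ⟨b, x, rfl, hwne⟩, hadj, -⟩
    · cases b
      · exact .inl (hfalse x rfl)
      · exact .inr ⟨⟨_, rfl⟩, by simp [joinDepth]⟩
    · cases b
      · obtain ⟨y, hy, -⟩ := joinCopies_attach (fun h => hwne (by rw [h])) hadj
        exact .inl (hfalse y hy)
      · exact .inr (mem_branchSet_of_adj hn ⟨⟨_, rfl⟩, le_rfl⟩ hadj)
  · rintro (⟨x, -, hx⟩ | h)
    · exact absurd hx (by simp)
    · exact none_notMem_branchSet _ h

/-- If two lions clear `T` from its root in `s` steps, and the paths are longer than `s + 3`, then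
two lions clear the graph made of two copies of `T` from its root. -/
theorem PairRun.joinCopies {s : ℕ} {p : Bool → Option V} (hsn : s + 4 ≤ n)
    (h : PairRun T r s (fun _ => some r) {r}ᶜ p ∅) :
    ∃ p', PairRun (joinCopies n T r) none (n + 3 * s + 9) (fun _ => some none) {none}ᶜ p' ∅ := by
  have h1 := pairRun_walkDown (n := n) (T := T) (r := r)
  have h2 := pairRun_gather (n := n) (T := T) (r := r) (by omega)
  have h3 := h.copy (n := n) false (fun k => branchSet V n (k + 1))
    (fun k _ => none_notMem_branchSet _) (fun k _ => branchSet_mono (by omega))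
    (fun k hk v w hw hadj => mem_branchSet_of_adj (by omega) hw hadj)
  have h4 := (h1.trans h2).trans h3
  rw [Set.image_empty, Set.empty_union] at h4
  -- The position `none` is the universal vertex; the new root is `some none`.
  have h5 := h4.tail (p'' := fun _ => none) (W'' := branchSet V n (s + 2))
    (pairStep_branchSet (by omega) fun l => ?_) (none_notMem_branchSet _)
  swap
  · cases p l
    · exact .inl rfl
    · exact .inr trivial
  -- By the end of this step contamination has reached depth at most `s + 3`, so both lions land
  -- just above it.
  have h6 := h5.tail (p'' := fun l => some (joinPath n r true (s + 4)))
    (W'' := walkSet n r (fun _ => true) (s + 4)) ⟨fun l => .inr trivial, ?_⟩ ?_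
  · have h7 := h6.trans (pairRun_walkSet (fun _ => true) (by omega))
    have h8 := h.copy (n := n) true (fun _ => ∅) (by simp) (by simp) (by simp)
    have e : walkSet n r (fun _ => true) 0 = (fun x => some (true, .inl x)) '' {r}ᶜ ∪ ∅ := by
      ext v
      simp only [walkSet, Set.union_empty, Set.mem_ofPred_eq, Set.mem_image]
      constructor
      · rintro ⟨⟨-, x | j, rfl⟩, h, h'⟩
        · exact ⟨x, fun e => h' true (by rw [Set.mem_singleton_iff.1 e]; rfl), rfl⟩
        · simp [joinDepth] at h
      · rintro ⟨x, hx, rfl⟩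
        refine ⟨⟨true, _, rfl⟩, le_rfl, fun _ h => hx ?_⟩
        simpa [joinPath] using h
    rw [e] at h7
    have h9 := h7.trans h8
    rw [Set.image_empty, Set.empty_union] at h9
    rw [show n + 3 * s + 9 = n + 1 + 2 + s + 1 + 1 + (s + 4) + s by omega]
    exact ⟨_, h9⟩
  · intro v hfree hv
    have hv' : v ∈ branchSet V n (s + 3) :=
      (pairStep_branchSet (T := T) (r := r) (d := s + 2) (p := fun _ => none) (p' := fun _ => none)
        (by omega) fun _ => .inl rfl).2 v (by simp) (hv.imp_right fun ⟨w, hw, hadj, _⟩ =>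
          ⟨w, hw, hadj, by simp⟩)
    obtain ⟨⟨x, rfl⟩, hd⟩ := hv'
    exact ⟨⟨true, x, rfl⟩, by omega, fun l h => hfree l (by rw [h])⟩
  · rintro ⟨⟨l, x, hx⟩, -⟩
    exact absurd hx (by simp)

theorem exists_pairRun_tree (i : ℕ) : ∃ s ≤ clearTime (i + 1), ∃ p,
    PairRun (tree (i + 1)) (treeRoot (i + 1)) s (fun _ => some (treeRoot (i + 1)))
      {treeRoot (i + 1)}ᶜ p ∅ := by
  induction i with
  | zero =>
    have h := pairRun_walkDown (n := 0) (T := tree 0) (r := treeRoot 0)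
    have e : walkSet 0 (treeRoot 0) id 0 = ∅ := by
      refine Set.eq_empty_of_forall_notMem ?_
      rintro v ⟨⟨l, x | j, rfl⟩, -, h⟩
      · exact h l rfl
      · exact j.elim0
    rw [e] at h
    exact ⟨1, le_rfl, _, h⟩
  | succ i ih =>
    obtain ⟨s, hs, p, h⟩ := ih
    obtain ⟨p', h'⟩ := h.joinCopies (n := gap (i + 1)) (by simp only [gap]; omega)
    refine ⟨_, ?_, p', h'⟩
    -- With `t = clearTime (i + 1)` the run takes at most `(t + 5) + 3 * t + 9 = 4 * t + 14` steps.
    simp only [gap, clearTime]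
    omega

theorem lionNumber_lionGraph_le (i : ℕ) : lionNumber (lionGraph (i + 1)) ≤ 3 := by
  obtain ⟨s, -, p, h⟩ := exists_pairRun_tree i
  exact Nat.sInf_le h.clearable

end Clearing

/-! ### Pathwidth lower bound -/

section LowerBound

variable {V X : Type*}

/-- The set `K` is empty or contains `r` and is connected in `T`. -/
def RootConnected (T : SimpleGraph V) (r : V) (K : Set V) : Prop :=
  K = ∅ ∨ r ∈ K ∧ ∀ P : Set V, r ∈ P → (∀ x ∈ P, ∀ y ∈ K, T.Adj x y → y ∈ P) → K ⊆ P

/-- Either the root has the property, which then spreads from it to all of `K`, or its failure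
spreads in the same way by symmetry of adjacency. -/
theorem RootConnected.mem {T : SimpleGraph V} {r : V} {K : Set V} (h : RootConnected T r K)
    {P : Set V} (hP : ∀ x ∈ K, ∀ y ∈ K, T.Adj x y → x ∈ P → y ∈ P) {x y : V} (hx : x ∈ K)
    (hxP : x ∈ P) (hy : y ∈ K) : y ∈ P := by
  rcases h with rfl | ⟨hr, h⟩
  · exact absurd hx (Set.notMem_empty _)
  by_cases hrP : r ∈ P
  · exact (h (P ∩ K) ⟨hrP, hr⟩ (fun a ha b hb hab => ⟨hP a ha.2 b hb hab ha.1, hb⟩) hy).1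
  · refine absurd hxP (h (Pᶜ ∩ K) ⟨hrP, hr⟩ (fun a ha b hb hab => ⟨fun hbP => ha.1 ?_, hb⟩) hx).1
    exact hP b hb a ha.2 hab.symm hbP

/-- The new root, the two paths, and the set `K b` in copy `b`. -/
def joinSet (n : ℕ) (K : Bool → Set V) : Set (JoinVertex V n) :=
  {v | ∀ b x, v = some (b, .inl x) → x ∈ K b}

theorem RootConnected.joinSet {T : SimpleGraph V} {r : V} {n : ℕ} {K : Bool → Set V}
    (h : ∀ b, RootConnected T r (K b)) :
    RootConnected (joinCopies n T r) none (joinSet n K) := by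
  refine .inr ⟨fun b x h => absurd h (by simp), fun P hr hP => ?_⟩
  -- The descent stops at index `1`: index `0` is the root of the copy, which is missing when `K b`
  -- is empty.
  have hpath : ∀ b, ∀ k ≤ n, joinPath n r b (n + 1 - k) ∈ P := by
    intro b k
    induction k with
    | zero => intro _; rwa [Nat.sub_zero, joinPath_last]
    | succ k ih =>
      intro hk
      obtain ⟨j, hj⟩ : ∃ j, n = k + j + 1 := ⟨n - k - 1, by omega⟩
      have h1 := ih (by omega)
      rw [show n + 1 - k = (j + 1) + 1 by omega] at h1
      rw [show n + 1 - (k + 1) = j + 1 by omega]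
      refine hP _ h1 _ (fun c x hx => ?_) (joinCopies_adj_joinPath b (by omega))
      have := congrArg (joinDepth n) hx
      rw [joinDepth_joinPath b (by omega)] at this
      simp [joinDepth] at this
  rintro (_ | ⟨b, x | j⟩) hv
  · exact hr
  · have hx : x ∈ K b := hv b x rfl
    rcases h b with h | ⟨hrK, h⟩
    · simp [h] at hx
    · refine h {y | some (b, .inl y) ∈ P} ?_ (fun y hy z hz hyz => ?_) hx
      · have h1 := hpath b n le_rfl
        rw [show n + 1 - n = 0 + 1 by omega] at h1
        refine hP _ h1 _ ?_ (joinCopies_adj_joinPath b (Nat.zero_le _))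
        intro c y hy
        simp only [Option.some.injEq, Prod.mk.injEq, Sum.inl.injEq] at hy
        exact hy.1 ▸ hy.2 ▸ hrK
      · refine hP _ hy _ (fun c w hw => ?_) (joinCopies_adj_inl hyz)
        simp only [Option.some.injEq, Prod.mk.injEq, Sum.inl.injEq] at hw
        exact hw.1 ▸ hw.2 ▸ hz
  · have hj := j.2
    have h1 := hpath b (n - j) (by omega)
    rw [show n + 1 - (n - j) = j + 1 by omega] at h1
    simpa [joinPath] using h1

theorem rootConnected_tree (i : ℕ) : RootConnected (tree i) (treeRoot i) Set.univ := by
  induction i with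
  | zero => exact .inr ⟨trivial, fun P hP _ _ _ => hP⟩
  | succ i ih =>
    have h := RootConnected.joinSet (n := gap i) (K := fun _ => Set.univ) fun _ => ih
    have e : Lions.joinSet (gap i) (fun _ => (Set.univ : Set (TreeVertex i))) = Set.univ :=
      Set.eq_univ_of_forall fun _ _ _ _ => trivial
    rw [e] at h
    exact h

/-- The four copies of `T_i` in `T_{i+2}`. -/
def treeCopy (i : ℕ) (c : Bool × Bool) (x : TreeVertex i) : TreeVertex (i + 2) :=
  (some (c.1, .inl (some (c.2, .inl x) : JoinVertex (TreeVertex i) (gap i))) :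
    JoinVertex (JoinVertex (TreeVertex i) (gap i)) (gap (i + 1)))

theorem treeCopy_inj {i : ℕ} {c d : Bool × Bool} {x y : TreeVertex i} :
    treeCopy i c x = treeCopy i d y ↔ c = d ∧ x = y := by
  refine ⟨fun h => ?_, by rintro ⟨rfl, rfl⟩; rfl⟩
  have h1 := Prod.mk.inj (Option.some.inj h)
  have h2 := Prod.mk.inj (Option.some.inj (Sum.inl.inj h1.2))
  exact ⟨Prod.ext h1.1 h2.1, Sum.inl.inj h2.2⟩

theorem tree_adj_treeCopy {i : ℕ} {c : Bool × Bool} {x y : TreeVertex i} (h : (tree i).Adj x y) :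
    (tree (i + 2)).Adj (treeCopy i c x) (treeCopy i c y) :=
  joinCopies_adj_inl (T := tree (i + 1)) (joinCopies_adj_inl h)

/-- The complement arises from two joins, the inner one with `K = ∅` on the deleted copy; this is
why the empty set counts as root-connected. -/
theorem rootConnected_compl_treeCopy (i : ℕ) (c : Bool × Bool) :
    RootConnected (tree (i + 2)) (treeRoot (i + 2)) (Set.range (treeCopy i c))ᶜ := by
  have h := RootConnected.joinSet (n := gap i) (K := fun b => {_x | b ≠ c.2}) (T := tree i)
    (r := treeRoot i) fun b => by
      by_cases hb : b = c.2
      · exact .inl (by simp [hb])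
      · simpa [hb] using rootConnected_tree i
  have h' := RootConnected.joinSet (n := gap (i + 1)) (T := tree (i + 1)) (r := treeRoot (i + 1))
    (K := fun b => {x | b = c.1 → x ∈ Lions.joinSet (gap i)
      fun b => ({_x | b ≠ c.2} : Set (TreeVertex i))}) fun b => by
      by_cases hb : b = c.1
      · simp only [hb, forall_const]
        exact h
      · simpa [hb] using rootConnected_tree (i + 1)
  have e : Lions.joinSet (gap (i + 1)) (fun b => {x | b = c.1 → x ∈ Lions.joinSet (gap i)
      fun b => ({_x | b ≠ c.2} : Set (TreeVertex i))}) = (Set.range (treeCopy i c))ᶜ := by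
    ext v
    constructor
    · rintro hv ⟨x, rfl⟩
      exact hv c.1 _ rfl rfl c.2 x rfl rfl
    · rintro hv b x rfl rfl b x rfl rfl
      exact hv ⟨x, rfl⟩
  exact e.subst (motive := RootConnected (tree (i + 2)) (treeRoot (i + 2))) h'

open Classical in
/-- If a copy of a tree `T_i` is contained in a graph, then every path decomposition of the
graph has a bag with more than `⌈i / 2⌉` vertices of the copy. -/
theorem PathDecomposition.exists_bag_card {H : SimpleGraph X} (D : PathDecomposition H) :
    ∀ (i : ℕ) (f : TreeVertex i → X), Function.Injective f →
      (∀ x y, (tree i).Adj x y → H.Adj (f x) (f y)) →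
      ∃ j, (i + 1) / 2 + 1 ≤ ((D.bag j).filter (· ∈ Set.range f)).card
  | 0, f, _, _ => by
    obtain ⟨j, hj⟩ := D.cover (f (treeRoot 0))
    exact ⟨j, Finset.card_pos.2 ⟨_, Finset.mem_filter.2 ⟨hj, _, rfl⟩⟩⟩
  | 1, f, hf, hom => by
    have hadj : (tree 1).Adj (treeRoot 1) _ :=
      joinCopies_adj_joinPath (n := 0) (T := tree 0) (r := treeRoot 0) true le_rfl
    obtain ⟨j, h1, h2⟩ := D.edge _ _ (hom _ _ hadj)
    exact ⟨j, Finset.one_lt_card.2 ⟨_, Finset.mem_filter.2 ⟨h1, _, rfl⟩, _,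
      Finset.mem_filter.2 ⟨h2, _, rfl⟩, fun h => hadj.ne (hf h)⟩⟩
  | i + 2, f, hf, hom => by
    have ih := fun c => D.exists_bag_card i (f ∘ treeCopy i c)
      (hf.comp fun x y h => (treeCopy_inj.1 h).2) fun x y h => hom _ _ (tree_adj_treeCopy h)
    choose J hJ using ih
    have meets : ∀ c, ∃ x, f (treeCopy i c x) ∈ D.bag (J c) := fun c => by
      obtain ⟨y, hy⟩ := Finset.card_pos.1 (Nat.lt_of_lt_of_le (Nat.succ_pos _) (hJ c))
      obtain ⟨hy, x, rfl⟩ := Finset.mem_filter.1 hy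
      exact ⟨x, hy⟩
    have key : ∀ c₁ c c₂ : Bool × Bool, c₁ ≠ c → c₂ ≠ c → J c₁ ≤ J c → J c ≤ J c₂ →
        ∃ j, (i + 2 + 1) / 2 + 1 ≤ ((D.bag j).filter (· ∈ Set.range f)).card := by
      intro c₁ c c₂ h₁ h₂ hle₁ hle₂
      have hcross : ∃ v ∉ Set.range (treeCopy i c), f v ∈ D.bag (J c) := by
        -- Otherwise each vertex outside copy `c` has all its bags on one side of `J c`.
        -- Connectedness makes the side common to all, but `c₁` has a vertex to the left and `c₂`
        -- one to the right.
        by_contra! hno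
        have side : ∀ v ∉ Set.range (treeCopy i c), ∀ j k, f v ∈ D.bag j → f v ∈ D.bag k →
            j < J c → k < J c := fun v hv j k hj hk hlt => by
          by_contra! hge
          exact hno v hv (D.interval j k (J c) hlt.le hge _ hj hk)
        obtain ⟨x₁, hx₁⟩ := meets c₁
        obtain ⟨x₂, hx₂⟩ := meets c₂
        have hK : ∀ d x, d ≠ c → treeCopy i d x ∉ Set.range (treeCopy i c) := by
          rintro d x hd ⟨y, hy⟩
          exact hd (treeCopy_inj.1 hy).1.symm
        have hlt : J c₁ < J c :=
          hle₁.lt_of_ne fun e => hno _ (hK c₁ x₁ h₁) (e ▸ hx₁)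
        have hclosed : ∀ x ∉ Set.range (treeCopy i c), ∀ y ∉ Set.range (treeCopy i c),
            (tree (i + 2)).Adj x y → (∃ j, f x ∈ D.bag j ∧ j < J c) →
              ∃ j, f y ∈ D.bag j ∧ j < J c := by
          rintro x hx y - hxy ⟨j, hj, hjlt⟩
          obtain ⟨k, hk, hk'⟩ := D.edge _ _ (hom _ _ hxy)
          exact ⟨k, hk', side x hx j k hj hk hjlt⟩
        obtain ⟨j, hj, hjlt⟩ := (rootConnected_compl_treeCopy i c).mem
          (P := {v | ∃ j, f v ∈ D.bag j ∧ j < J c}) hclosed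
          (hK c₁ x₁ h₁) ⟨_, hx₁, hlt⟩ (hK c₂ x₂ h₂)
        exact absurd (side _ (hK c₂ x₂ h₂) _ _ hj hx₂ hjlt) hle₂.not_gt
      obtain ⟨v, hv, hvJ⟩ := hcross
      have hsub : (D.bag (J c)).filter (· ∈ Set.range (f ∘ treeCopy i c)) ⊂
          (D.bag (J c)).filter (· ∈ Set.range f) := by
        refine Finset.ssubset_iff_subset_ne.2 ⟨fun x hx => ?_, fun e => ?_⟩
        · obtain ⟨hx, y, rfl⟩ := Finset.mem_filter.1 hx
          exact Finset.mem_filter.2 ⟨hx, _, rfl⟩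
        · have : f v ∈ (D.bag (J c)).filter (· ∈ Set.range f) :=
            Finset.mem_filter.2 ⟨hvJ, v, rfl⟩
          rw [← e] at this
          obtain ⟨-, y, hy⟩ := Finset.mem_filter.1 this
          exact hv ⟨y, hf hy⟩
      refine ⟨J c, ?_⟩
      have h1 := hJ c
      have h2 := Finset.card_lt_card hsub
      omega
    -- Three of the four copies suffice; `c` is the one with the median index.
    rcases le_total (J (false, false)) (J (false, true)) with h1 | h1 <;>
      rcases le_total (J (false, true)) (J (true, false)) with h2 | h2 <;>
      rcases le_total (J (false, false)) (J (true, false)) with h3 | h3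
    · exact key _ _ _ (by decide) (by decide) h1 h2
    · exact key _ _ _ (by decide) (by decide) h1 h2
    · exact key _ _ _ (by decide) (by decide) h3 h2
    · exact key _ _ _ (by decide) (by decide) h3 h1
    · exact key _ _ _ (by decide) (by decide) h1 h3
    · exact key _ _ _ (by decide) (by decide) h2 h3
    · exact key _ _ _ (by decide) (by decide) h2 h1
    · exact key _ _ _ (by decide) (by decide) h2 h1

theorem le_pathwidth_lionGraph (i : ℕ) : (i + 1) / 2 ≤ pathwidth (lionGraph i) := by
  classical
  obtain ⟨D, hD⟩ := exists_width_eq_pathwidth (lionGraph i)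
  obtain ⟨j, hj⟩ := D.exists_bag_card i some (Option.some_injective _) fun _ _ h => h
  rw [← hD, PathDecomposition.width]
  have h1 := Finset.card_filter_le (D.bag j) (· ∈ Set.range (some : TreeVertex i → _))
  have h2 := Finset.le_sup (f := fun i => (D.bag i).card) (Finset.mem_univ j)
  refine Nat.le_sub_of_add_le ((hj.trans ?_).trans h2)
  convert h1

end LowerBound

/-! ### Connectedness and conclusion -/

theorem addUniversal_connected {V : Type*} (G : SimpleGraph V) : (addUniversal G).Connected := by
  have h : ∀ v, (addUniversal G).Reachable none v := by
    rintro (_ | v)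
    · rfl
    · exact SimpleGraph.Adj.reachable (by trivial)
  exact ⟨fun v w => (h v).symm.trans (h w)⟩

end Lions

theorem mainTheorem7 :
    (∀ k : ℕ, 0 < k → ∃ (V : Type) (_ : Fintype V) (G : SimpleGraph V),
      G.Connected ∧ Lions.lionNumber G ≤ 3 ∧ k ≤ Lions.pathwidth G) ∧
    (∀ i : ℕ, 1 ≤ i → (Lions.lionGraph i).Connected ∧
      Lions.lionNumber (Lions.lionGraph i) ≤ 3 ∧
      ⌈(i : ℚ) / 2⌉₊ ≤ Lions.pathwidth (Lions.lionGraph i)) := by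
  have main : ∀ i : ℕ, 1 ≤ i → (Lions.lionGraph i).Connected ∧
      Lions.lionNumber (Lions.lionGraph i) ≤ 3 ∧
      (i + 1) / 2 ≤ Lions.pathwidth (Lions.lionGraph i) := by
    rintro (_ | i) hi
    · omega
    · exact ⟨Lions.addUniversal_connected _, Lions.lionNumber_lionGraph_le i,
        Lions.le_pathwidth_lionGraph _⟩
  refine ⟨fun k hk => ?_, fun i hi => ?_⟩
  · obtain ⟨h1, h2, h3⟩ := main (2 * k) (by omega)
    exact ⟨_, Fintype.ofFinite _, Lions.lionGraph (2 * k), h1, h2, by omega⟩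
  · obtain ⟨h1, h2, h3⟩ := main i hi
    refine ⟨h1, h2, (Nat.ceil_le.2 ?_).trans h3⟩
    have : i ≤ 2 * ((i + 1) / 2) := by omega
    have h : (i : ℚ) ≤ 2 * ((i + 1) / 2 : ℕ) := by exact_mod_cast this
    linarith
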